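/- Let $P,Q\in\mathbb C[T]$ be polynomials of degree at least $2$ with $P(0)=Q(0)=0$, let $F:\mathbb C^2\to\mathbb C^2$, $F(z,w)=(P(z),Q(w))$, and suppose that one of the following holds: (1) $P(z)=z^m$ for some $m$, and $0<|Q'(0)|<1$; (2) $P(z)=z^m$ for some $m$, and $Q'(0)=1$; (3) $0<|P'(0)|<1$ and $Q'(0)=1$; (4) $P'(0)=Q'(0)=1$. Let $\Omega$ be an immediate basin of the fixed point $(0,0)$ of $F$, that is, a connected component of the interior of $\{x\in\mathbb C^2: F^n(x)\to(0,0)\}$ such that $F(\Omega)\subseteq\Omega$. (In case (1) it is the component containing $(0,0)$; in the other cases there can be several, according to the attracting directions at the parabolic fixed point $0$ of $Q$, or of $P$ and $Q$.) Then there is an $r>0$ such that for every point $p\in\mathbb C^2$ with $\|p\|<r$ (in particular for $p=(0,0)$) and for every constant $C>0$ there exists a point $(z_0,w_0)\in\Omega$ such that $$d_\Omega\big((z_0,w_0),(\tilde z,\tilde w)\big)\ \ge\ C\qquad\text{for all } (\tilde z,\tilde w)\in\Omega\cap\bigcup_{k\ge0}F^{-k}(p).$$ Here $d_\Omega$ is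 the Kobayashi distance on $\Omega$: $d_\Omega(x,y)$ is the infimum of $\int_0^1 K_\Omega(\gamma(t),\gamma'(t))\,dt$ over the piecewise $C^1$ curves $\gamma:[0,1]\to\Omega$ from $x$ to $y$, where $K_\Omega(x,\xi)=\inf\{\lambda>0:\ \exists f:\{|\zeta|<1\}\to\Omega\text{ holomorphic},\ f(0)=x,\ \lambda f'(0)=\xi\}$. -/

import Mathlib

open Set Filter Topology MeasureTheory
open scoped ENNReal

noncomputable section

/-- The infinitesimal Kobayashi metric of `Ω` at the point `z` in the direction `ξ`: the infimum of
the `r > 0` for which some holomorphic map `f` from the unit disc to `Ω` satisfies `f 0 = z` and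
`r • f' 0 = ξ`. -/
def kobayashiMetric {E : Type*} [NormedAddCommGroup E] [NormedSpace ℂ E]
    (Ω : Set E) (z ξ : E) : ℝ≥0∞ :=
  sInf {l : ℝ≥0∞ | ∃ (r : ℝ) (f : ℂ → E), 0 < r ∧ l = ENNReal.ofReal r ∧
    DifferentiableOn ℂ f (Metric.ball 0 1) ∧ MapsTo f (Metric.ball 0 1) Ω ∧
    f 0 = z ∧ (r : ℂ) • deriv f 0 = ξ}

/-- `γ` is a piecewise `C¹` curve `[0, 1] → Ω` from `x` to `y` (values of `γ` off `[0, 1]` play no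
role). -/
structure IsPiecewiseC1Curve {E : Type*} [NormedAddCommGroup E] [NormedSpace ℂ E]
    (Ω : Set E) (x y : E) (γ : ℝ → E) : Prop where
  mapsTo : MapsTo γ (Icc 0 1) Ω
  source : γ 0 = x
  target : γ 1 = y
  continuousOn : ContinuousOn γ (Icc 0 1)
  piecewise : ∃ (n : ℕ) (t : ℕ → ℝ), Monotone t ∧ t 0 = 0 ∧ t n = 1 ∧
    ∀ i < n, ContDiffOn ℝ 1 γ (Icc (t i) (t (i + 1)))

/-- The Kobayashi length of a curve parametrized by `[0, 1]`. -/
def kobayashiLength {E : Type*} [NormedAddCommGroup E] [NormedSpace ℂ E]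
    (Ω : Set E) (γ : ℝ → E) : ℝ≥0∞ :=
  ∫⁻ t in Icc (0 : ℝ) 1, kobayashiMetric Ω (γ t) (deriv γ t)

/-- The Kobayashi distance of `Ω`: the infimum of the Kobayashi lengths of the piecewise `C¹` curves
in `Ω` joining the two points (`⊤` if there are none). -/
def kobayashiDist {E : Type*} [NormedAddCommGroup E] [NormedSpace ℂ E]
    (Ω : Set E) (x y : E) : ℝ≥0∞ :=
  sInf {l : ℝ≥0∞ | ∃ γ : ℝ → E, IsPiecewiseC1Curve Ω x y γ ∧ l = kobayashiLength Ω γ}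

/-- The set of points whose forward orbit under `f` converges to `p`. -/
def attractionBasin {X : Type*} [TopologicalSpace X] (f : X → X) (p : X) : Set X :=
  {x | Tendsto (fun n : ℕ => f^[n] x) atTop (𝓝 p)}

/-- `Ω` is an immediate basin of the fixed point `p` of `f`: a connected component of the interior
of the set of points attracted to `p` which is mapped into itself by `f`. For an attracting fixed
point the set of attracted points is open and `Ω` is its component containing `p`. For a parabolic
fixed point of multiplier `1` of a polynomial, taking the interior discards the iterated preimages of
`p`, which lie in the Julia set, and there is one such `Ω` for each attracting direction at `p`. -/
def IsImmediateBasin {X : Type*} [TopologicalSpace X] (f : X → X) (p : X) (Ω : Set X) : Prop :=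
  (∃ x ∈ interior (attractionBasin f p),
    Ω = connectedComponentIn (interior (attractionBasin f p)) x) ∧
  MapsTo f Ω Ω

/-- The product map `(z, w) ↦ (P z, Q w)` of `ℂ²`. -/
def productMap (P Q : Polynomial ℂ) (x : ℂ × ℂ) : ℂ × ℂ :=
  (P.eval x.1, Q.eval x.2)

end

/-! The basin is a product `Ω = U × V` of bounded planar components. If `a` is a boundary point of
`U`, comparison with a punctured disc about `a` shows that `log log (2M / |z - a|)` is 2-Lipschitz
for `kobayashiDist`. It blows up at `a`, so some `z ∈ U` has its whole fibre far from the fibres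
over a given finite set. Applied at every boundary point, the same estimate confines the projection
of a Kobayashi ball to a compact subset of `U`. Likewise for `V`.

Suppose `p.1 ≠ 0`. Iterates of `P` tend to 0 uniformly on the compact set belonging to a fixed `z`
and radius `C`, so preimages of high order are far from the fibre over `z`. The finitely many
remaining orders give finitely many second coordinates, and `w` is chosen far from those. The case
`p.2 ≠ 0` is symmetric.

For `p = (0, 0)`: if `P = z ^ m`, all preimages lie over `z = 0`, and `z` is chosen far from 0. If
`Q'(0) = 1`, then `0 ∉ V`, and `Ω` contains no preimage at all. -/

/-! ### Schwarz lemmas for half-planes and punctured discs. -/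

/-- Schwarz lemma for maps from the unit disc to a half-plane. -/
theorem norm_deriv_zero_le_of_re_lt {h : ℂ → ℂ} {M : ℝ}
    (hd : DifferentiableOn ℂ h (Metric.ball 0 1)) (hM : ∀ z ∈ Metric.ball (0 : ℂ) 1, (h z).re < M) :
    ‖deriv h 0‖ ≤ 2 * (M - (h 0).re) := by
  have h0 : (0 : ℂ) ∈ Metric.ball (0 : ℂ) 1 := by simp
  -- `c` is the reflection of `h 0` in the line `Re = M`, so `q` below is `h` followed by the Cayley
  -- transform sending `h 0` to 0.
  set c : ℂ := 2 * M - (starRingEnd ℂ) (h 0) with hc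
  have hre : ∀ z ∈ Metric.ball (0 : ℂ) 1, 0 < (c - h z).re := by
    intro z hz
    have := hM z hz
    have := hM 0 h0
    simp [hc]
    linarith
  have hne : ∀ z ∈ Metric.ball (0 : ℂ) 1, c - h z ≠ 0 := fun z hz e => by
    have := hre z hz
    simp [e] at this
  set q : ℂ → ℂ := fun z => (h z - h 0) / (c - h z) with hq
  have hqd : DifferentiableOn ℂ q (Metric.ball 0 1) :=
    (hd.sub_const _).div (hd.const_sub _) hne
  have hmaps : MapsTo q (Metric.ball 0 1) (Metric.closedBall (q 0) 1) := by
    intro z hz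
    have h1 := hM z hz
    have h2 := hM 0 h0
    simp only [hq, sub_self, zero_div, mem_closedBall_zero_iff, norm_div]
    rw [div_le_one (norm_pos_iff.2 (hne z hz)), Complex.norm_def, Complex.norm_def]
    apply Real.sqrt_le_sqrt
    simp only [Complex.normSq_apply, hc]
    simp
    -- `|c - h z|² - |h z - h 0|² = 4 (M - Re h z) (M - Re h 0)`.
    nlinarith [mul_pos (sub_pos.2 h1) (sub_pos.2 h2)]
  have hb := Complex.norm_deriv_le_one_of_mapsTo_ball hqd hmaps one_pos
  have hh : HasDerivAt h (deriv h 0) 0 :=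
    (hd.differentiableAt (Metric.ball_mem_nhds _ one_pos)).hasDerivAt
  have hqq : HasDerivAt q (deriv h 0 / (c - h 0)) 0 := by
    have := (hh.sub_const (h 0)).div (hh.const_sub c) (hne 0 h0)
    refine this.congr_deriv ?_
    have := hne 0 h0
    field_simp
    ring
  rw [hqq.deriv, norm_div, div_le_one (norm_pos_iff.2 (hne 0 h0))] at hb
  have hc0 : c - h 0 = ((2 * (M - (h 0).re) : ℝ) : ℂ) := by
    apply Complex.ext <;> simp [hc]
    ring
  rw [hc0, Complex.norm_real, Real.norm_of_nonneg] at hb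
  · exact hb
  · linarith [hM 0 h0]

/-- A nonvanishing holomorphic function on the unit disc has a holomorphic logarithm. -/
theorem exists_eq_exp_of_ne_zero {g : ℂ → ℂ} (hd : DifferentiableOn ℂ g (Metric.ball 0 1))
    (hg : ∀ z ∈ Metric.ball (0 : ℂ) 1, g z ≠ 0) :
    ∃ h : ℂ → ℂ, DifferentiableOn ℂ h (Metric.ball 0 1) ∧
      ∀ z ∈ Metric.ball (0 : ℂ) 1, g z = Complex.exp (h z) := by
  have h0 : (0 : ℂ) ∈ Metric.ball (0 : ℂ) 1 := by simp
  have hq : DifferentiableOn ℂ (fun z => deriv g z / g z) (Metric.ball 0 1) :=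
    (hd.deriv Metric.isOpen_ball).div hd hg
  obtain ⟨F, hF⟩ := hq.isExactOn_ball
  have hconst : ∀ z ∈ Metric.ball (0 : ℂ) 1,
      g z * Complex.exp (-F z) = g 0 * Complex.exp (-F 0) := by
    intro z hz
    have hder : ∀ x ∈ Metric.ball (0 : ℂ) 1,
        HasDerivAt (fun z => g z * Complex.exp (-F z)) 0 x := by
      intro x hx
      have h1 := (hd.differentiableAt (Metric.isOpen_ball.mem_nhds hx)).hasDerivAt
      have := h1.mul (hF x hx).neg.cexp
      refine this.congr_deriv ?_
      have := hg x hx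
      field_simp
      ring
    exact (convex_ball (0 : ℂ) 1).is_const_of_fderivWithin_eq_zero (𝕜 := ℂ)
      (fun x hx => (hder x hx).differentiableAt.differentiableWithinAt)
      (fun x hx => by
        rw [fderivWithin_of_isOpen Metric.isOpen_ball hx]
        have := (hder x hx).hasFDerivAt.fderiv
        rw [this]; ext; simp) hz h0
  refine ⟨fun z => F z + (Complex.log (g 0) - F 0), fun z hz =>
    (hF z hz).differentiableAt.differentiableWithinAt.add_const _, fun z hz => ?_⟩
  rw [Complex.exp_add, Complex.exp_sub, Complex.exp_log (hg 0 h0)]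
  have := hconst z hz
  rw [Complex.exp_neg, Complex.exp_neg] at this
  field_simp at this ⊢
  rw [this]

/-- Schwarz lemma for maps from the unit disc to a punctured disc. -/
theorem norm_deriv_zero_le_of_mapsTo_punctured {g : ℂ → ℂ} {R : ℝ}
    (hd : DifferentiableOn ℂ g (Metric.ball 0 1))
    (hg : ∀ z ∈ Metric.ball (0 : ℂ) 1, 0 < ‖g z‖ ∧ ‖g z‖ < R) :
    ‖deriv g 0‖ ≤ 2 * (‖g 0‖ * Real.log (R / ‖g 0‖)) := by
  have h0 : (0 : ℂ) ∈ Metric.ball (0 : ℂ) 1 := by simp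
  obtain ⟨h, hh, heq⟩ := exists_eq_exp_of_ne_zero hd fun z hz => norm_pos_iff.1 (hg z hz).1
  have hre : ∀ z ∈ Metric.ball (0 : ℂ) 1, (h z).re = Real.log ‖g z‖ := fun z hz => by
    rw [heq z hz, Complex.norm_exp, Real.log_exp]
  have hb := norm_deriv_zero_le_of_re_lt (M := Real.log R) hh fun z hz => by
    rw [hre z hz]
    exact Real.log_lt_log (hg z hz).1 (hg z hz).2
  have hder : deriv g 0 = g 0 * deriv h 0 := by
    have h1 : HasDerivAt h (deriv h 0) 0 :=
      (hh.differentiableAt (Metric.ball_mem_nhds _ one_pos)).hasDerivAt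
    have : g =ᶠ[𝓝 0] fun z => Complex.exp (h z) := by
      filter_upwards [Metric.ball_mem_nhds (0 : ℂ) one_pos] with z hz using heq z hz
    rw [this.deriv_eq, h1.cexp.deriv, ← heq 0 h0]
  have hpos := (hg 0 h0).1
  rw [hder, norm_mul, Real.log_div (hpos.trans (hg 0 h0).2).ne' hpos.ne', ← hre 0 h0]
  calc _ ≤ ‖g 0‖ * (2 * (Real.log R - (h 0).re)) := by gcongr
    _ = _ := by ring

/-! ### Comparison of the Kobayashi distance with a punctured disc. -/

section PuncturedDisc

variable {E : Type*} [NormedAddCommGroup E] [NormedSpace ℂ E] {Ω : Set E} {L : E →L[ℂ] ℂ} {a : ℂ}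
  {R : ℝ}

/-- Composing a competing disc with `L - a` gives a map into a punctured disc, to which the Schwarz
lemma applies. -/
theorem ofReal_le_kobayashiMetric (hΩ : ∀ x ∈ Ω, 0 < ‖L x - a‖ ∧ ‖L x - a‖ < R) {x : E}
    (hx : x ∈ Ω) (ξ : E) :
    ENNReal.ofReal (‖L ξ‖ / (2 * (‖L x - a‖ * Real.log (R / ‖L x - a‖)))) ≤
      kobayashiMetric Ω x ξ := by
  refine le_sInf ?_
  rintro l ⟨r, f, hr, rfl, hf, hmaps, hfx, hfξ⟩
  apply ENNReal.ofReal_le_ofReal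
  have hg : DifferentiableOn ℂ (fun z => L (f z) - a) (Metric.ball 0 1) :=
    (L.differentiable.comp_differentiableOn hf).sub_const a
  have hb := norm_deriv_zero_le_of_mapsTo_punctured hg fun z hz => hΩ _ (hmaps hz)
  have hf0 : HasDerivAt f (deriv f 0) 0 :=
    (hf.differentiableAt (Metric.ball_mem_nhds _ one_pos)).hasDerivAt
  have hder : deriv (fun z => L (f z) - a) 0 = L (deriv f 0) :=
    ((L.hasFDerivAt.comp_hasDerivAt (0 : ℂ) hf0).sub_const a).deriv
  rw [hder, hfx] at hb
  have hlog : 0 < Real.log (R / ‖L x - a‖) :=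
    Real.log_pos ((one_lt_div (hΩ x hx).1).2 (hΩ x hx).2)
  have := (hΩ x hx).1
  rw [div_le_iff₀ (by positivity), ← hfξ, map_smul, norm_smul, Complex.norm_real,
    Real.norm_of_nonneg hr.le]
  gcongr

theorem hasDerivAt_log_log_norm {c : ℝ → ℂ} {c' : ℂ} {t : ℝ} (hc : HasDerivAt c c' t)
    (h0 : 0 < ‖c t‖) (hR : ‖c t‖ < R) :
    ∃ u' : ℝ, HasDerivAt (fun s => Real.log (Real.log (R / ‖c s‖))) u' t ∧
      |u'| ≤ ‖c'‖ / (‖c t‖ * Real.log (R / ‖c t‖)) := by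
  have hlog : 0 < Real.log (R / ‖c t‖) := Real.log_pos ((one_lt_div h0).2 hR)
  have hn : DifferentiableAt ℝ (fun z : ℂ => ‖z‖) (c t) :=
    (contDiffAt_norm ℝ (n := 1) (norm_pos_iff.1 h0)).differentiableAt (by simp)
  have hn1 : ‖fderiv ℝ (fun z : ℂ => ‖z‖) (c t)‖ ≤ 1 := by
    simpa using norm_fderiv_le_of_lipschitz ℝ (x₀ := c t) (lipschitzWith_one_norm (E := ℂ))
  have hnc : HasDerivAt (fun s => ‖c s‖) (fderiv ℝ (fun z : ℂ => ‖z‖) (c t) c') t :=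
    hn.hasFDerivAt.comp_hasDerivAt t hc
  set n' := fderiv ℝ (fun z : ℂ => ‖z‖) (c t) c' with hn'
  have hbound : |n'| ≤ ‖c'‖ := by
    have := (fderiv ℝ (fun z : ℂ => ‖z‖) (c t)).le_of_opNorm_le hn1 c'
    simpa using this
  have hR0 : 0 < R := h0.trans hR
  have h1 : HasDerivAt (fun s => R / ‖c s‖) (R * (-n' / ‖c t‖ ^ 2)) t := by
    simpa [div_eq_mul_inv] using (hnc.inv h0.ne').const_mul R
  refine ⟨_, (h1.log (by positivity)).log hlog.ne', ?_⟩
  have e : R * (-n' / ‖c t‖ ^ 2) / (R / ‖c t‖) / Real.log (R / ‖c t‖) =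
      -n' / (‖c t‖ * Real.log (R / ‖c t‖)) := by
    field_simp
  rw [e, abs_div, abs_neg, abs_of_pos (mul_pos h0 hlog)]
  gcongr

theorem ofReal_abs_sub_le_lintegral (hΩ : ∀ x ∈ Ω, 0 < ‖L x - a‖ ∧ ‖L x - a‖ < R)
    {γ : ℝ → E} {s t : ℝ} (hst : s ≤ t) (hγ : ContDiffOn ℝ 1 γ (Icc s t))
    (hmaps : MapsTo γ (Icc s t) Ω) :
    ENNReal.ofReal |Real.log (Real.log (R / ‖L (γ t) - a‖)) -
        Real.log (Real.log (R / ‖L (γ s) - a‖))| ≤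
      2 * ∫⁻ τ in Ioc s t, kobayashiMetric Ω (γ τ) (deriv γ τ) := by
  rcases hst.eq_or_lt with rfl | hlt
  · simp
  set u : ℝ → ℝ := fun τ => Real.log (Real.log (R / ‖L (γ τ) - a‖)) with hu
  have hpos : ∀ τ ∈ Icc s t, 0 < ‖L (γ τ) - a‖ := fun τ hτ => (hΩ _ (hmaps hτ)).1
  have hlog : ∀ τ ∈ Icc s t, 0 < Real.log (R / ‖L (γ τ) - a‖) := fun τ hτ =>
    Real.log_pos ((one_lt_div (hpos τ hτ)).2 (hΩ _ (hmaps hτ)).2)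
  have hR0 : 0 < R := by
    have := hΩ _ (hmaps (left_mem_Icc.2 hst))
    exact this.1.trans this.2
  have hcd : ContDiffOn ℝ 1 u (Icc s t) := by
    have h1 : ContDiffOn ℝ 1 (fun τ => L (γ τ) - a) (Icc s t) :=
      ((L.restrictScalars ℝ).contDiff.comp_contDiffOn hγ).sub contDiffOn_const
    have h2 := h1.norm ℝ fun τ hτ => norm_pos_iff.1 (hpos τ hτ)
    have h3 : ContDiffOn ℝ 1 (fun τ => R / ‖L (γ τ) - a‖) (Icc s t) :=
      contDiffOn_const.div h2 fun τ hτ => (hpos τ hτ).ne'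
    exact (h3.log fun τ hτ => (div_pos hR0 (hpos τ hτ)).ne').log fun τ hτ => (hlog τ hτ).ne'
  have hud : UniqueDiffOn ℝ (Icc s t) := uniqueDiffOn_Icc hlt
  have hcont : ContinuousOn (derivWithin u (Icc s t)) (Icc s t) :=
    hcd.continuousOn_derivWithin hud le_rfl
  have hnhds : ∀ τ ∈ Ioo s t, Icc s t ∈ 𝓝 τ := fun τ hτ => Icc_mem_nhds hτ.1 hτ.2
  have hder : ∀ τ ∈ Ioo s t, HasDerivAt u (derivWithin u (Icc s t) τ) τ := by
    intro τ hτ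
    rw [derivWithin_of_mem_nhds (hnhds τ hτ)]
    exact ((hcd.contDiffAt (hnhds τ hτ)).differentiableAt (by simp)).hasDerivAt
  have hint : u t - u s = ∫ τ in s..t, derivWithin u (Icc s t) τ :=
    (intervalIntegral.integral_eq_sub_of_hasDerivAt_of_le hst hcd.continuousOn hder
      (hcont.intervalIntegrable_of_Icc hst)).symm
  change ENNReal.ofReal |u t - u s| ≤ _
  rw [hint, intervalIntegral.integral_of_le hst, ← Real.norm_eq_abs, ofReal_norm]
  refine (enorm_integral_le_lintegral_enorm _).trans ?_
  -- At the endpoints of a piece `deriv γ` need not be the one-sided derivative; they form a null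
  -- set.
  rw [← lintegral_const_mul' _ _ (by simp), ← restrict_Ioo_eq_restrict_Ioc]
  refine lintegral_mono_ae ?_
  filter_upwards [ae_restrict_mem measurableSet_Ioo] with τ hτ
  have hτ' := Ioo_subset_Icc_self hτ
  have hγτ : HasDerivAt γ (deriv γ τ) τ :=
    ((hγ.contDiffAt (hnhds τ hτ)).differentiableAt (by simp)).hasDerivAt
  have hLγ : HasDerivAt (fun τ => L (γ τ) - a) (L (deriv γ τ)) τ :=
    ((L.restrictScalars ℝ).hasFDerivAt.comp_hasDerivAt τ hγτ).sub_const a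
  obtain ⟨u', hu', hle⟩ := hasDerivAt_log_log_norm hLγ (hpos τ hτ') (hΩ _ (hmaps hτ')).2
  rw [(hder τ hτ).unique hu']
  calc ‖u'‖ₑ = ENNReal.ofReal |u'| := by rw [← Real.norm_eq_abs, ofReal_norm]
    _ ≤ ENNReal.ofReal (2 * (‖L (deriv γ τ)‖ /
          (2 * (‖L (γ τ) - a‖ * Real.log (R / ‖L (γ τ) - a‖))))) := by
        apply ENNReal.ofReal_le_ofReal
        refine hle.trans (le_of_eq ?_)
        have := hpos τ hτ'
        have := hlog τ hτ'
        field_simp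
    _ ≤ _ := by
        rw [ENNReal.ofReal_mul zero_le_two, ENNReal.ofReal_ofNat]
        gcongr
        exact ofReal_le_kobayashiMetric hΩ (hmaps hτ') _

/-- The iterated logarithm of the distance to an omitted point is Lipschitz for the Kobayashi
distance. -/
theorem ofReal_abs_sub_le_kobayashiDist (hΩ : ∀ x ∈ Ω, 0 < ‖L x - a‖ ∧ ‖L x - a‖ < R) (x y : E) :
    ENNReal.ofReal |Real.log (Real.log (R / ‖L y - a‖)) - Real.log (Real.log (R / ‖L x - a‖))| ≤
      2 * kobayashiDist Ω x y := by
  have key : ∀ γ : ℝ → E, IsPiecewiseC1Curve Ω x y γ →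
      ENNReal.ofReal |Real.log (Real.log (R / ‖L y - a‖)) -
        Real.log (Real.log (R / ‖L x - a‖))| ≤ 2 * kobayashiLength Ω γ := by
    intro γ hγ
    obtain ⟨n, t, hmono, ht0, htn, hpw⟩ := hγ.piecewise
    have step : ∀ i ≤ n, ENNReal.ofReal |Real.log (Real.log (R / ‖L (γ (t i)) - a‖)) -
        Real.log (Real.log (R / ‖L (γ (t 0)) - a‖))| ≤
        2 * ∫⁻ τ in Ioc (t 0) (t i), kobayashiMetric Ω (γ τ) (deriv γ τ) := by
      intro i
      induction i with
      | zero => simp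
      | succ i ih =>
        intro hi
        have hmaps : MapsTo γ (Icc (t i) (t (i + 1))) Ω := hγ.mapsTo.mono_left
          (Icc_subset_Icc (ht0 ▸ hmono (Nat.zero_le _)) (htn ▸ hmono hi))
        have h1 := ofReal_abs_sub_le_lintegral hΩ (hmono i.le_succ) (hpw i hi) hmaps
        have h2 := ih (Nat.le_of_succ_le hi)
        rw [← Ioc_union_Ioc_eq_Ioc (hmono (Nat.zero_le i)) (hmono i.le_succ),
          lintegral_union measurableSet_Ioc (Ioc_disjoint_Ioc_of_le le_rfl), mul_add]
        refine le_trans ?_ (add_le_add h2 h1)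
        rw [← ENNReal.ofReal_add (abs_nonneg _) (abs_nonneg _)]
        apply ENNReal.ofReal_le_ofReal
        rw [add_comm |_ - _|]
        exact abs_sub_le _ _ _
    have := step n le_rfl
    rw [ht0, htn, hγ.source, hγ.target] at this
    refine this.trans ?_
    unfold kobayashiLength
    gcongr
    exact Ioc_subset_Icc_self
  rw [mul_comm, ← ENNReal.div_le_iff_le_mul (by simp) (by simp)]
  refine le_sInf ?_
  rintro l ⟨γ, hγ, rfl⟩
  rw [ENNReal.div_le_iff_le_mul (by simp) (by simp), mul_comm]
  exact key γ hγ

end PuncturedDisc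

/-! ### Fibres over bounded planar open sets. -/

section Projection

variable {E : Type*} [NormedAddCommGroup E] [NormedSpace ℂ E] {Ω : Set E} {L : E →L[ℂ] ℂ}
  {U : Set ℂ}

theorem abs_log_log_sub_lt {a : ℂ} {R C : ℝ} {x y : E}
    (hΩ : ∀ x ∈ Ω, 0 < ‖L x - a‖ ∧ ‖L x - a‖ < R)
    (hC : kobayashiDist Ω x y < ENNReal.ofReal C) :
    |Real.log (Real.log (R / ‖L y - a‖)) - Real.log (Real.log (R / ‖L x - a‖))| < 2 * C := by
  have h1 := ofReal_abs_sub_le_kobayashiDist hΩ x y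
  have h2 : 2 * kobayashiDist Ω x y < ENNReal.ofReal (2 * C) := by
    rw [ENNReal.ofReal_mul zero_le_two, ENNReal.ofReal_ofNat]
    exact (ENNReal.mul_lt_mul_iff_right (by simp) (by simp)).2 hC
  exact (ENNReal.ofReal_lt_ofReal_iff_of_nonneg (abs_nonneg _)).1 (h1.trans_lt h2)

theorem norm_sub_lt_of_mem_closure {M : ℝ} (hM : U ⊆ Metric.ball 0 M) {a z : ℂ}
    (ha : a ∈ closure U) (hz : z ∈ U) : ‖z - a‖ < 2 * M := by
  have h1 : ‖a‖ ≤ M := by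
    have := Metric.closure_ball_subset_closedBall (closure_mono hM ha)
    simpa using this
  have h2 : ‖z‖ < M := by simpa using hM hz
  linarith [norm_sub_le z a]

/-- Points over a bounded open set may be chosen Kobayashi-far from all points over a given finite
set. -/
theorem exists_forall_le_kobayashiDist (hU : IsOpen U) (hb : Bornology.IsBounded U)
    (hne : U.Nonempty) (hL : MapsTo L Ω U) {S : Set ℂ} (hS : S.Finite) (C : ℝ) :
    ∃ z ∈ U, ∀ x ∈ Ω, ∀ y ∈ Ω, L x = z → L y ∈ S → ENNReal.ofReal C ≤ kobayashiDist Ω x y := by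
  obtain ⟨M, hM⟩ := hb.subset_ball 0
  have huniv : U ≠ univ := fun h => by
    rw [h] at hb
    exact NormedSpace.unbounded_univ ℂ ℂ hb
  obtain ⟨a, ha⟩ := nonempty_frontier_iff.2 ⟨hne, huniv⟩
  have haU : a ∉ U := by
    rw [hU.frontier_eq] at ha
    exact ha.2
  have hac : a ∈ closure U := frontier_subset_closure ha
  set u : ℂ → ℝ := fun z => Real.log (Real.log (2 * M / ‖z - a‖)) with hu
  have hM0 : 0 < 2 * M := (norm_nonneg _).trans_lt (norm_sub_lt_of_mem_closure hM hac hne.some_mem)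
  have hpos : ∀ z ∈ U, 0 < ‖z - a‖ := fun z hz =>
    norm_pos_iff.2 (sub_ne_zero.2 fun h => haU (h ▸ hz))
  have hΩ : ∀ x ∈ Ω, 0 < ‖L x - a‖ ∧ ‖L x - a‖ < 2 * M := fun x hx =>
    ⟨hpos _ (hL hx), norm_sub_lt_of_mem_closure hM hac (hL hx)⟩
  have htend : Tendsto u (𝓝[U] a) atTop := by
    refine Real.tendsto_log_atTop.comp (Real.tendsto_log_atTop.comp ?_)
    refine Tendsto.const_mul_atTop hM0 (tendsto_inv_nhdsGT_zero.comp ?_)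
    refine tendsto_nhdsWithin_iff.2 ⟨?_, eventually_mem_nhdsWithin.mono hpos⟩
    have : Tendsto (fun z : ℂ => ‖z - a‖) (𝓝 a) (𝓝 ‖a - a‖) :=
      (continuous_id.sub continuous_const).norm.tendsto a
    rw [sub_self, norm_zero] at this
    exact this.mono_left nhdsWithin_le_nhds
  obtain ⟨B, hB⟩ := (hS.image u).bddAbove
  have : (𝓝[U] a).NeBot := mem_closure_iff_nhdsWithin_neBot.1 hac
  -- The gap `2 * C` between `u z` and the values of `u` on `S` forces distance at least `C`, by the
  -- Lipschitz constant 2.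
  obtain ⟨z, hz, hzU⟩ := ((htend.eventually_ge_atTop (B + 2 * C)).and
    eventually_mem_nhdsWithin).exists
  refine ⟨z, hzU, fun x hx y hy hxz hyS => ?_⟩
  by_contra! hlt
  have h1 := abs_log_log_sub_lt hΩ hlt
  have h2 : u (L y) ≤ B := hB (mem_image_of_mem u hyS)
  have h3 : u (L x) ≥ B + 2 * C := by rw [hxz]; exact hz
  have := (abs_lt.1 h1).1
  simp only [hu] at h2 h3
  linarith

/-- Kobayashi balls project into compact subsets of a bounded open set. -/
theorem exists_isCompact_of_kobayashiDist_lt (hU : IsOpen U) (hb : Bornology.IsBounded U)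
    (hL : MapsTo L Ω U) {z : ℂ} (hz : z ∈ U) (C : ℝ) :
    ∃ K ⊆ U, IsCompact K ∧ ∀ x ∈ Ω, ∀ y ∈ Ω, L x = z →
      kobayashiDist Ω x y < ENNReal.ofReal C → L y ∈ K := by
  obtain ⟨M, hM⟩ := hb.subset_ball 0
  obtain ⟨δ, hδ, hball⟩ := Metric.isOpen_iff.1 hU z hz
  have hfU : ∀ a ∈ frontier U, a ∉ U := fun a ha => by
    rw [hU.frontier_eq] at ha
    exact ha.2
  -- Solves `log (2M / ε) = exp (2C) * log (2M / δ)`; it does not depend on the boundary point `a`.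
  set ε : ℝ := 2 * M * Real.exp (-(Real.exp (2 * C) * Real.log (2 * M / δ))) with hε
  have hM0 : 0 < 2 * M := (norm_nonneg _).trans_lt
    (norm_sub_lt_of_mem_closure hM (subset_closure hz) hz)
  have hε0 : 0 < ε := by positivity
  refine ⟨closure U ∩ ⋂ a ∈ frontier U, {w | ε ≤ ‖w - a‖}, ?_, ?_, ?_⟩
  · rintro w ⟨hw, hw'⟩
    by_contra hwU
    have hf : w ∈ frontier U := by
      rw [hU.frontier_eq]
      exact ⟨hw, hwU⟩
    have := mem_iInter₂.1 hw' w hf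
    simp only [sub_self, norm_zero, mem_ofPred_eq] at this
    linarith
  · refine hb.isCompact_closure.inter_right (isClosed_biInter fun a _ => ?_)
    exact isClosed_le continuous_const (continuous_id.sub continuous_const).norm
  · intro x hx y hy hxz hlt
    refine ⟨subset_closure (hL hy), mem_iInter₂.2 fun a ha => ?_⟩
    have hac := frontier_subset_closure ha
    have hpos : ∀ w ∈ U, 0 < ‖w - a‖ := fun w hw =>
      norm_pos_iff.2 (sub_ne_zero.2 fun h => hfU a ha (h ▸ hw))
    have hΩ : ∀ x ∈ Ω, 0 < ‖L x - a‖ ∧ ‖L x - a‖ < 2 * M := fun x hx =>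
      ⟨hpos _ (hL hx), norm_sub_lt_of_mem_closure hM hac (hL hx)⟩
    have hlog : ∀ x ∈ Ω, 0 < Real.log (2 * M / ‖L x - a‖) := fun x hx =>
      Real.log_pos ((one_lt_div (hΩ x hx).1).2 (hΩ x hx).2)
    have h1 := (abs_lt.1 (abs_log_log_sub_lt hΩ hlt)).2
    have hδa : δ ≤ ‖L x - a‖ := by
      by_contra! h
      refine hfU a ha (hball ?_)
      rwa [Metric.mem_ball, dist_comm, dist_eq_norm, ← hxz]
    have h2 : Real.log (2 * M / ‖L x - a‖) ≤ Real.log (2 * M / δ) := by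
      have := (hΩ x hx).1
      gcongr
    have h3 : Real.log (2 * M / ‖L y - a‖) ≤ Real.exp (2 * C) * Real.log (2 * M / δ) := by
      have : Real.log (Real.log (2 * M / ‖L y - a‖)) ≤
          2 * C + Real.log (Real.log (2 * M / ‖L x - a‖)) := by linarith
      have := Real.exp_le_exp.2 this
      rw [Real.exp_log (hlog y hy), Real.exp_add, Real.exp_log (hlog x hx)] at this
      exact this.trans (by gcongr)
    have hy0 := (hΩ y hy).1
    have h4 := (Real.log_le_iff_le_exp (div_pos hM0 hy0)).1 h3
    rw [div_le_iff₀ hy0] at h4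
    rw [mem_ofPred_eq, hε, Real.exp_neg, ← div_eq_mul_inv, div_le_iff₀ (Real.exp_pos _)]
    linarith

end Projection

/-! ### Locally uniform convergence and the choice of a far point. -/

/-- A pointwise null sequence of holomorphic functions that is uniformly bounded on an open set
tends to zero locally uniformly there. -/
theorem tendstoLocallyUniformlyOn_zero {f : ℕ → ℂ → ℂ} {U : Set ℂ} {M : ℝ} (hU : IsOpen U)
    (hf : ∀ n, DifferentiableOn ℂ (f n) U) (hM : ∀ n, ∀ z ∈ U, ‖f n z‖ ≤ M)
    (hlim : ∀ z ∈ U, Tendsto (fun n => f n z) atTop (𝓝 0)) :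
    TendstoLocallyUniformlyOn f 0 atTop U := by
  rw [Metric.tendstoLocallyUniformlyOn_iff]
  intro ε hε x hx
  obtain ⟨δ, hδ, hball⟩ := Metric.isOpen_iff.1 hU x hx
  have hM0 : 0 ≤ M := (norm_nonneg _).trans (hM 0 x hx)
  -- The Schwarz estimate with slope `2M / δ` keeps the oscillation below `ε / 2`; `M + 1` allows
  -- for `M = 0`.
  set η : ℝ := min δ (ε * δ / (4 * (M + 1))) with hη
  have hη0 : 0 < η := by positivity
  refine ⟨Metric.ball x η, mem_nhdsWithin_of_mem_nhds (Metric.ball_mem_nhds x hη0), ?_⟩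
  have hx0 := (Metric.tendsto_nhds.1 (hlim x hx)) (ε / 2) (half_pos hε)
  filter_upwards [hx0] with n hn y hy
  have hyδ : y ∈ Metric.ball x δ := Metric.ball_subset_ball (min_le_left _ _) hy
  have hmaps : MapsTo (f n) (Metric.ball x δ) (Metric.closedBall (f n x) (2 * M)) := fun z hz => by
    rw [mem_closedBall_iff_norm]
    linarith [norm_sub_le (f n z) (f n x), hM n z (hball hz), hM n x hx]
  have h1 := Complex.dist_le_div_mul_dist_of_mapsTo_ball ((hf n).mono hball) hmaps hyδ
  have h2 : dist y x ≤ ε * δ / (4 * (M + 1)) := (Metric.mem_ball.1 hy).le.trans (min_le_right _ _)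
  have h3 : dist (f n y) (f n x) < ε / 2 := by
    calc _ ≤ 2 * M / δ * (ε * δ / (4 * (M + 1))) := h1.trans (by gcongr)
      _ = ε / 2 * (M / (M + 1)) := by field_simp; ring
      _ < ε / 2 * 1 := by
        gcongr
        rw [div_lt_one (by positivity)]
        linarith
      _ = ε / 2 := mul_one _
  rw [Pi.zero_apply, dist_comm]
  linarith [dist_triangle (f n y) (f n x) 0]

/-- If a factor of a product-like set carries holomorphic maps converging locally uniformly to a
value different from `p`, then there are points arbitrarily Kobayashi-far from all common solutions
of `f k = p`, `g k = q`. -/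
theorem exists_far_of_tendstoLocallyUniformlyOn {E : Type*} [NormedAddCommGroup E]
    [NormedSpace ℂ E] {Ω : Set E} {L₁ L₂ : E →L[ℂ] ℂ} {U V : Set ℂ} (hU : IsOpen U)
    (hUb : Bornology.IsBounded U) (hUne : U.Nonempty) (hV : IsOpen V)
    (hVb : Bornology.IsBounded V) (hVne : V.Nonempty) (h₁ : MapsTo L₁ Ω U) (h₂ : MapsTo L₂ Ω V)
    (hsurj : ∀ z ∈ U, ∀ w ∈ V, ∃ x ∈ Ω, L₁ x = z ∧ L₂ x = w) {f g : ℕ → ℂ → ℂ} {p q : ℂ}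
    (hf : TendstoLocallyUniformlyOn f 0 atTop U) (hp : p ≠ 0)
    (hg : ∀ k, {w | g k w = q}.Finite) (C : ℝ) :
    ∃ x₀ ∈ Ω, ∀ (k : ℕ), ∀ x ∈ Ω, f k (L₁ x) = p → g k (L₂ x) = q →
      ENNReal.ofReal C ≤ kobayashiDist Ω x₀ x := by
  obtain ⟨z, hz⟩ := hUne
  obtain ⟨K, hKU, hK, hKd⟩ := exists_isCompact_of_kobayashiDist_lt hU hUb h₁ hz C
  have hunif := (tendstoLocallyUniformlyOn_iff_forall_isCompact hU).1 hf K hKU hK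
  obtain ⟨N, hN⟩ := eventually_atTop.1
    (Metric.tendstoUniformlyOn_iff.1 hunif ‖p‖ (norm_pos_iff.2 hp))
  have hfin : (⋃ k ∈ Iio N, {w | g k w = q}).Finite := (finite_Iio N).biUnion fun k _ => hg k
  -- The order matters: `z` and `C` fix `K`, hence `N`, hence the finite set that `w` must avoid.
  obtain ⟨w, hw, hwd⟩ := exists_forall_le_kobayashiDist hV hVb hVne h₂ hfin C
  obtain ⟨x₀, hx₀, rfl, rfl⟩ := hsurj z hz w hw
  refine ⟨x₀, hx₀, fun k x hx hfk hgk => ?_⟩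
  by_cases hk : k < N
  · exact hwd x₀ hx₀ x hx rfl (mem_biUnion hk hgk)
  · by_contra! hlt
    have := hN k (not_lt.1 hk) _ (hKd x₀ hx₀ x hx rfl hlt)
    rw [hfk] at this
    simp at this

/-! ### Basins of polynomials in one variable. -/

section Polynomial

variable {P : Polynomial ℂ}

theorem iterate_eval_eq (P : Polynomial ℂ) (n : ℕ) :
    ∃ p : Polynomial ℂ, (fun z => P.eval z)^[n] = fun z => p.eval z :=
  ⟨P.comp^[n] Polynomial.X, by ext z; simp [Polynomial.iterate_comp_eval]⟩

theorem differentiable_iterate_eval (P : Polynomial ℂ) (n : ℕ) :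
    Differentiable ℂ (fun z => P.eval z)^[n] := by
  obtain ⟨p, hp⟩ := iterate_eval_eq P n
  rw [hp]
  exact p.differentiable

theorem finite_iterate_eval_eq (hP : 2 ≤ P.natDegree) (n : ℕ) (q : ℂ) :
    {w | (fun z => P.eval z)^[n] w = q}.Finite := by
  induction n generalizing q with
  | zero => simp
  | succ n ih =>
    have : {w | (fun z => P.eval z)^[n + 1] w = q} =
        (fun z => P.eval z)^[n] ⁻¹' {w | P.eval w = q} := by
      ext w
      simp [Function.iterate_succ_apply']
    rw [this]
    refine Set.Finite.preimage' ?_ fun b _ => ih b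
    have hne : P - Polynomial.C q ≠ 0 := fun h => by
      rw [sub_eq_zero.1 h, Polynomial.natDegree_C] at hP
      omega
    refine (P - Polynomial.C q).roots.toFinset.finite_toSet.subset fun w hw => ?_
    simpa [hne, sub_eq_zero] using hw

/-- Far from 0 one has `‖z‖ ≤ ‖P z‖`, so an orbit starting there never comes closer to 0. -/
theorem isBounded_attractionBasin_eval (hP : 2 ≤ P.natDegree) :
    Bornology.IsBounded (attractionBasin (fun z => P.eval z) 0) := by
  have hdeg : (Polynomial.X : Polynomial ℂ).degree < P.degree := by
    apply Polynomial.degree_lt_degree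
    rw [Polynomial.natDegree_X]
    omega
  have h := (Polynomial.isLittleO_cobounded_of_degree_lt (P := Polynomial.X) (Q := P) hdeg).bound
    (c := 1) one_pos
  obtain ⟨R, hR⟩ := (Metric.hasBasis_cobounded_compl_closedBall (0 : ℂ)).eventually_iff.1 h
  have hR' : ∀ z : ℂ, max R 1 < ‖z‖ → ‖z‖ ≤ ‖P.eval z‖ := fun z hz => by
    have := hR.2 (x := z) (by simpa using (le_max_left R 1).trans_lt hz)
    simpa using this
  refine (Metric.isBounded_closedBall (x := (0 : ℂ)) (r := max R 1)).subset fun z hz => ?_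
  by_contra hz'
  have hz1 : max R 1 < ‖z‖ := by simpa using hz'
  have hn : ∀ n, max R 1 < ‖(fun z => P.eval z)^[n] z‖ := by
    intro n
    induction n with
    | zero => exact hz1
    | succ n ih =>
      rw [Function.iterate_succ_apply']
      exact ih.trans_le (hR' _ ih)
  have hlim : Tendsto (fun n : ℕ => ‖(fun z => P.eval z)^[n] z‖) atTop (𝓝 ‖(0 : ℂ)‖) :=
    Tendsto.norm hz
  have := ge_of_tendsto' hlim fun n => (hn n).le
  rw [norm_zero] at this
  linarith [le_max_right R 1]

theorem mapsTo_attractionBasin {X : Type*} [TopologicalSpace X] (f : X → X) (p : X) (n : ℕ) :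
    MapsTo f^[n] (attractionBasin f p) (attractionBasin f p) := fun x hx => by
  have : Tendsto (fun k => f^[k + n] x) atTop (𝓝 p) := (tendsto_add_atTop_iff_nat n).2 hx
  simpa [attractionBasin, Function.iterate_add_apply] using this

theorem tendstoLocallyUniformlyOn_iterate_eval (hP : 2 ≤ P.natDegree) :
    TendstoLocallyUniformlyOn (fun n => (fun z => P.eval z)^[n]) 0 atTop
      (interior (attractionBasin (fun z => P.eval z) 0)) := by
  obtain ⟨M, hM⟩ := (isBounded_attractionBasin_eval hP).exists_norm_le
  exact tendstoLocallyUniformlyOn_zero isOpen_interior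
    (fun n => (differentiable_iterate_eval P n).differentiableOn)
    (fun n z hz => hM _ (mapsTo_attractionBasin _ _ n (interior_subset hz)))
    fun z hz => interior_subset hz

theorem hasDerivAt_iterate_eval_zero (h0 : P.eval 0 = 0) (h1 : P.derivative.eval 0 = 1) (n : ℕ) :
    HasDerivAt (fun z => P.eval z)^[n] 1 0 := by
  have h : HasDerivAt (fun z => P.eval z) 1 0 := h1 ▸ P.hasDerivAt 0
  simpa using HasDerivAt.iterate (0 : ℂ) h h0 n

/-- A parabolic fixed point of multiplier one is not interior to its basin. -/
theorem zero_notMem_interior_attractionBasin (hP : 2 ≤ P.natDegree) (h0 : P.eval 0 = 0)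
    (h1 : P.derivative.eval 0 = 1) :
    (0 : ℂ) ∉ interior (attractionBasin (fun z => P.eval z) 0) := by
  intro hmem
  -- By Weierstrass the derivatives of the iterates at 0 would tend to 0, yet each equals 1.
  have h := (tendstoLocallyUniformlyOn_iterate_eval hP).deriv
    (Eventually.of_forall fun n => (differentiable_iterate_eval P n).differentiableOn)
    isOpen_interior
  have h2 := h.tendsto_at hmem
  have h3 : deriv (0 : ℂ → ℂ) 0 = 0 := by
    rw [show (0 : ℂ → ℂ) = fun _ => 0 from rfl, deriv_const]
  simp only [Function.comp_def, (hasDerivAt_iterate_eval_zero h0 h1 _).deriv] at h2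
  rw [h3] at h2
  exact one_ne_zero (tendsto_nhds_unique tendsto_const_nhds h2)

end Polynomial

/-! ### Product structure and the main theorem. -/

theorem connectedComponentIn_prod {X Y : Type*} [TopologicalSpace X] [TopologicalSpace Y]
    {A : Set X} {B : Set Y} {x : X × Y} (hx : x ∈ A ×ˢ B) :
    connectedComponentIn (A ×ˢ B) x = connectedComponentIn A x.1 ×ˢ connectedComponentIn B x.2 := by
  apply Subset.antisymm
  · intro y hy
    exact ⟨connectedComponentIn_mono _ (fst_image_prod_subset A B)
        (continuous_fst.continuousOn.mapsTo_connectedComponentIn hx hy),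
      connectedComponentIn_mono _ (snd_image_prod_subset A B)
        (continuous_snd.continuousOn.mapsTo_connectedComponentIn hx hy)⟩
  · exact (isPreconnected_connectedComponentIn.prod
      isPreconnected_connectedComponentIn).subset_connectedComponentIn
      ⟨mem_connectedComponentIn hx.1, mem_connectedComponentIn hx.2⟩
      (prod_mono (connectedComponentIn_subset _ _) (connectedComponentIn_subset _ _))

theorem iterate_productMap (P Q : Polynomial ℂ) (n : ℕ) (x : ℂ × ℂ) :
    (productMap P Q)^[n] x = ((fun z => P.eval z)^[n] x.1, (fun w => Q.eval w)^[n] x.2) := by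
  have : productMap P Q = Prod.map (fun z => P.eval z) (fun w => Q.eval w) := rfl
  rw [this, Prod.map_iterate]
  rfl

theorem attractionBasin_productMap (P Q : Polynomial ℂ) :
    attractionBasin (productMap P Q) (0, 0) =
      attractionBasin (fun z => P.eval z) 0 ×ˢ attractionBasin (fun w => Q.eval w) 0 := by
  ext x
  simp only [attractionBasin, iterate_productMap, mem_ofPred_eq, mem_prod, Prod.tendsto_iff]

theorem theorem3p3 (P Q : Polynomial ℂ) (hPdeg : 2 ≤ P.natDegree) (hQdeg : 2 ≤ Q.natDegree)
    (hP0 : P.eval 0 = 0) (hQ0 : Q.eval 0 = 0)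
    (hcases :
      ((∃ m : ℕ, P = Polynomial.X ^ m) ∧
        0 < ‖Q.derivative.eval 0‖ ∧ ‖Q.derivative.eval 0‖ < 1) ∨
      ((∃ m : ℕ, P = Polynomial.X ^ m) ∧ Q.derivative.eval 0 = 1) ∨
      ((0 < ‖P.derivative.eval 0‖ ∧ ‖P.derivative.eval 0‖ < 1) ∧ Q.derivative.eval 0 = 1) ∨
      (P.derivative.eval 0 = 1 ∧ Q.derivative.eval 0 = 1))
    (Ω : Set (ℂ × ℂ)) (hΩ : IsImmediateBasin (productMap P Q) (0, 0) Ω) :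
    ∃ r : ℝ, 0 < r ∧ ∀ p : ℂ × ℂ, ‖p‖ < r → ∀ C : ℝ, 0 < C →
      ∃ x₀ ∈ Ω, ∀ (k : ℕ) (x : ℂ × ℂ), x ∈ Ω → (productMap P Q)^[k] x = p →
        ENNReal.ofReal C ≤ kobayashiDist Ω x₀ x := by
  obtain ⟨⟨c, hc, hΩc⟩, hinv⟩ := hΩ
  rw [attractionBasin_productMap, interior_prod_eq] at hc hΩc
  rw [connectedComponentIn_prod hc] at hΩc
  set A := interior (attractionBasin (fun z => P.eval z) 0) with hA
  set B := interior (attractionBasin (fun w => Q.eval w) 0) with hB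
  set U := connectedComponentIn A c.1 with hUdef
  set V := connectedComponentIn B c.2 with hVdef
  have hU : IsOpen U := isOpen_interior.connectedComponentIn
  have hV : IsOpen V := isOpen_interior.connectedComponentIn
  have hUA : U ⊆ A := connectedComponentIn_subset _ _
  have hVB : V ⊆ B := connectedComponentIn_subset _ _
  have hUb : Bornology.IsBounded U :=
    (isBounded_attractionBasin_eval hPdeg).subset (hUA.trans interior_subset)
  have hVb : Bornology.IsBounded V :=
    (isBounded_attractionBasin_eval hQdeg).subset (hVB.trans interior_subset)
  have hUne : U.Nonempty := ⟨_, mem_connectedComponentIn hc.1⟩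
  have hVne : V.Nonempty := ⟨_, mem_connectedComponentIn hc.2⟩
  have h₁ : MapsTo (ContinuousLinearMap.fst ℂ ℂ ℂ) Ω U := fun x hx => (hΩc ▸ hx).1
  have h₂ : MapsTo (ContinuousLinearMap.snd ℂ ℂ ℂ) Ω V := fun x hx => (hΩc ▸ hx).2
  have hmem : ∀ z ∈ U, ∀ w ∈ V, (z, w) ∈ Ω := fun z hz w hw => hΩc ▸ ⟨hz, hw⟩
  -- The argument covers every `p`, so any radius will do.
  refine ⟨1, one_pos, fun p _ C _ => ?_⟩
  have hiter : ∀ k x, (productMap P Q)^[k] x = p →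
      (fun z => P.eval z)^[k] x.1 = p.1 ∧ (fun w => Q.eval w)^[k] x.2 = p.2 := by
    rintro k x rfl
    rw [iterate_productMap]
    exact ⟨rfl, rfl⟩
  by_cases hp1 : p.1 = 0
  swap
  · obtain ⟨x₀, hx₀, h⟩ := exists_far_of_tendstoLocallyUniformlyOn hU hUb hUne hV hVb hVne h₁ h₂
      (fun z hz w hw => ⟨(z, w), hmem z hz w hw, rfl, rfl⟩)
      ((tendstoLocallyUniformlyOn_iterate_eval hPdeg).mono hUA) hp1
      (fun k => finite_iterate_eval_eq hQdeg k p.2) C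
    exact ⟨x₀, hx₀, fun k x hx hk => h k x hx (hiter k x hk).1 (hiter k x hk).2⟩
  by_cases hp2 : p.2 = 0
  swap
  · obtain ⟨x₀, hx₀, h⟩ := exists_far_of_tendstoLocallyUniformlyOn hV hVb hVne hU hUb hUne h₂ h₁
      (fun w hw z hz => ⟨(z, w), hmem z hz w hw, rfl, rfl⟩)
      ((tendstoLocallyUniformlyOn_iterate_eval hQdeg).mono hVB) hp2
      (fun k => finite_iterate_eval_eq hPdeg k p.1) C
    exact ⟨x₀, hx₀, fun k x hx hk => h k x hx (hiter k x hk).2 (hiter k x hk).1⟩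
  have hor : (∃ m : ℕ, P = Polynomial.X ^ m) ∨ Q.derivative.eval 0 = 1 := by tauto
  rcases hor with ⟨m, rfl⟩ | hQ1
  · obtain ⟨z, hz, h⟩ := exists_forall_le_kobayashiDist hU hUb hUne h₁ (finite_singleton (0 : ℂ)) C
    obtain ⟨w, hw⟩ := hVne
    refine ⟨(z, w), hmem z hz w hw, fun k x hx hk => h _ (hmem z hz w hw) x hx rfl ?_⟩
    have hz0 := (hiter k x hk).1
    rw [hp1] at hz0
    clear hk
    simp only [Polynomial.eval_pow, Polynomial.eval_X, pow_iterate] at hz0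
    exact eq_zero_of_pow_eq_zero hz0
  · obtain ⟨z, hz⟩ := hUne
    obtain ⟨w, hw⟩ := hVne
    refine ⟨(z, w), hmem z hz w hw, fun k x hx hk => ?_⟩
    -- Invariance of `Ω` would put `p = (0, 0)` in `Ω`, hence 0 in the interior of the basin of `Q`.
    exfalso
    have hxk : (productMap P Q)^[k] x ∈ Ω := hinv.iterate k hx
    have hV0 := hVB (h₂ hxk)
    rw [hk] at hV0
    change p.2 ∈ B at hV0
    rw [hp2] at hV0
    exact zero_notMem_interior_attractionBasin hQdeg hQ0 hQ1 hV0
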